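/- **Setting.** Let $\mathcal M$ be a set of probability measures on a measurable space $\mathcal Z$. All Hilbert spaces are real; write $\oplus$ for Hilbert direct sums. For $P\in\mathcal M$ and $s\in L^2(P)$, let $\mathscr P(P,\mathcal M,s)$ be the set of families $\{P_\epsilon:\epsilon\in[0,1]\}\subseteq\mathcal M$ with $P_0=P$ that are quadratic mean differentiable at $\epsilon=0$ with score $s$, i.e. $\int\big(p_\epsilon^{1/2}-p^{1/2}-\tfrac{\epsilon}{2}s\,p^{1/2}\big)^2d\nu=o(\epsilon^2)$ as $\epsilon\to0$, where $p_\epsilon,p$ are the densities of $P_\epsilon,P$ with respect to a measure $\nu$ (which may depend on $\epsilon$) dominating both. For a subset $\mathcal U$ of a Hilbert space $\mathcal T$, $u\in\mathcal U$ and $t\in\mathcal T$, let $\mathscr P(u,\mathcal U,t)$ be the set of paths $\{u_\epsilon:\epsilon\in[0,1]\}\subseteq\mathcal U$ with $u_0=u$ and $\|u_\epsilon-u-\epsilon t\|_{\mathcal T}=o(\epsilon)$. The tangent sets are $\check{\mathcal M}_P=\{s:\mathscr P(P,\mathcal M,s)\neq\emptyset\}$ and $\check{\mathcal U}_u=\{t:\mathscr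 P(u,\mathcal U,t)\ne\emptyset\}$; the tangent spaces $\dot{\mathcal M}_P\subseteq L^2(P)$ and $\dot{\mathcal U}_u\subseteq\mathcal T$ are the closed linear spans of these sets. A map $\theta:\mathcal M\times\mathcal U\to\mathcal W$ into a Hilbert space $\mathcal W$ is *totally pathwise differentiable* at $(P,u)$ if there is a continuous linear $\dot\theta_{P,u}:\dot{\mathcal M}_P\oplus\dot{\mathcal U}_u\to\mathcal W$ such that $\|\theta(P_\epsilon,u_\epsilon)-\theta(P,u)-\epsilon\,\dot\theta_{P,u}(s,t)\|_{\mathcal W}=o(\epsilon)$ for all $s\in\check{\mathcal M}_P$, $t\in\check{\mathcal U}_u$, $\{P_\epsilon\}\in\mathscr P(P,\mathcal M,s)$ and $\{u_\epsilon\}\in\mathscr P(u,\mathcal U,t)$. The operator $\dot\theta_{P,u}$ is then unique; $\dot\theta_{P,u}^*:\mathcal W\to\dot{\mathcal M}_P\oplus\dot{\mathcal U}_u$ denotes its adjoint. Let $k\ge1$, and let $\mathcal W_1,\dots,\mathcal W_k$ be Hilbert spaces with $\mathcal W_k=\mathbb R$. For each $j\in[k]=\{1,\dots,k\}$ let $\mathrm{pa}(j)\subseteq\{1,\dots,j-1\}$,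 $\mathcal V_j\subseteq\mathcal W_j$, $\prod_{i\in\mathrm{pa}(j)}\mathcal V_i\subseteq\mathcal U_j\subseteq\bigoplus_{i\in\mathrm{pa}(j)}\mathcal W_i$ and $\theta_j:\mathcal M\times\mathcal U_j\to\mathcal V_j$ (when $\mathrm{pa}(j)=\emptyset$, the direct sum and $\mathcal U_j$ are $\{0\}$). Suppose $\psi:\mathcal M\to\mathbb R$ is the composition of these primitives: for every $P'\in\mathcal M$, $\psi(P')=h_k$, where $h_j=\theta_j(P',h_{\mathrm{pa}(j)})$ and $h_{\mathrm{pa}(j)}=(h_i)_{i\in\mathrm{pa}(j)}$ for $j=1,\dots,k$. **Perturbed forward and backward passes.** Fix $P\in\mathcal M$ and, for each $j\in[k]$, $s_j\in\check{\mathcal M}_P$ and $\{P_{j,\epsilon}:\epsilon\in[0,1]\}\in\mathscr P(P,\mathcal M,s_j)$. Let $L^2_0(Q)=\{g\in L^2(Q):\int g\,dQ=0\}$, and let $\delta_{j,\epsilon}\in L^2_0(P_{j,\epsilon})\oplus\bigoplus_{i\in\mathrm{pa}(j)}\mathcal W_i$ be errors with $\delta_{j,0}=0$ and $\|\delta_{j,\epsilon}\|\to0$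 as $\epsilon\to0$. For each $\epsilon\in[0,1]$: * forward pass: for $j=1,\dots,k$, set $h_{j,\epsilon}=\theta_j(P_{j,\epsilon},h_{\mathrm{pa}(j),\epsilon})$, where $h_{\mathrm{pa}(j),\epsilon}=(h_{i,\epsilon})_{i\in\mathrm{pa}(j)}$; * backward pass: initialize $f_{0,\epsilon},f_{1,\epsilon},\dots,f_{k-1,\epsilon}$ at zero and $f_{k,\epsilon}=1$; for $j=k,k-1,\dots,1$, set $\vartheta_{j,\epsilon}=\dot\theta_{j,P_{j,\epsilon},h_{\mathrm{pa}(j),\epsilon}}^*(f_{j,\epsilon})+\delta_{j,\epsilon}$ and add $\vartheta_{j,\epsilon}$ to $(f_{0,\epsilon},f_{\mathrm{pa}(j),\epsilon})$. Write $\vartheta_{j,\epsilon,0}\in L^2(P_{j,\epsilon})$ for the first entry of $\vartheta_{j,\epsilon}$. **Lemma.** Suppose all distributions in $\mathcal M$ are mutually absolutely continuous, and that each $\theta_j$, $j\in[k]$, is totally pathwise differentiable at $(P_{j,\epsilon},h_{\mathrm{pa}(j),\epsilon})$ for all $\epsilon\in[0,1]$. Suppose further that, for each $j\in[k]$, (i)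 there is a constant $c_j<\infty$ such that $|\vartheta_{j,\epsilon,0}|\le c_j$ $P$-a.s. for all sufficiently small $\epsilon$, and (ii) $\vartheta_{j,\epsilon,0}\to\vartheta_{j,0,0}$ in $L^2(P)$ as $\epsilon\to0$. Then $f_{0,\epsilon}$ is $P$-integrable for all sufficiently small $\epsilon$, and $$h_{k,\epsilon}+\int f_{0,\epsilon}(z)\,P(dz)-\psi(P)=o(\epsilon)\qquad\text{as }\epsilon\to0 .$$ -/

import Mathlib

open MeasureTheory Filter Topology Asymptotics

namespace AutoDiff

noncomputable section

/-! ## Smooth paths, tangent sets and tangent spaces -/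

section Paths

variable {Z : Type*} [MeasurableSpace Z]

/-- `L²(P)`. -/
abbrev L2 (P : ProbabilityMeasure Z) : Type _ := Lp ℝ 2 (P : Measure Z)

/-- The density of `Q` with respect to a finite measure `ν` that dominates it. -/
def density (Q : ProbabilityMeasure Z) (ν : Measure Z) (z : Z) : ℝ :=
  ((Q : Measure Z).rnDeriv ν z).toReal

/-- `{P_ε : ε ∈ [0,1]} ∈ 𝒫(P, M, s)`: a univariate submodel of `M` with `P_{ε=0} = P` that is
quadratic mean differentiable at `ε = 0` with score `s`, that is
`∫ (p_ε^{1/2} - p^{1/2} - ε s p^{1/2} / 2)² dν = o(ε²)`, where `p_ε` and `p` are the densities of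
`P_ε` and `P` with respect to a dominating measure `ν`. The integral does not depend on the
choice of the dominating measure; here it is `ν = P + P_ε`. -/
def IsModelPath (M : Set (ProbabilityMeasure Z)) (P : ProbabilityMeasure Z) (s : L2 P)
    (Pe : unitInterval → ProbabilityMeasure Z) : Prop :=
  (∀ ε, Pe ε ∈ M) ∧ Pe 0 = P ∧
    (fun ε : unitInterval =>
      ∫ z, (√(density (Pe ε) ((P : Measure Z) + (Pe ε : Measure Z)) z)
          - √(density P ((P : Measure Z) + (Pe ε : Measure Z)) z)
          - (ε : ℝ) * s z * √(density P ((P : Measure Z) + (Pe ε : Measure Z)) z) / 2) ^ 2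
        ∂((P : Measure Z) + (Pe ε : Measure Z)))
      =o[𝓝 (0 : unitInterval)] fun ε => (ε : ℝ) ^ 2

/-- The tangent set of the model `M` at `P`. -/
def modelTangentSet (M : Set (ProbabilityMeasure Z)) (P : ProbabilityMeasure Z) : Set (L2 P) :=
  {s | ∃ Pe, IsModelPath M P s Pe}

/-- The tangent space of the model `M` at `P`: the `L²(P)`-closure of the linear span of the
tangent set. -/
abbrev modelTangentSpace (M : Set (ProbabilityMeasure Z)) (P : ProbabilityMeasure Z) :
    Submodule ℝ (L2 P) :=
  (Submodule.span ℝ (modelTangentSet M P)).topologicalClosure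

variable {T : Type*} [NormedAddCommGroup T] [InnerProductSpace ℝ T]

/-- `{u_ε : ε ∈ [0,1]} ∈ 𝒫(u, U, t)`: a path in `U` with `‖u_ε - u - ε t‖ = o(ε)`. (The filter
`𝓝 0` on `[0,1]` contains `ε = 0`, so that `u_0 = u`.) -/
def IsHilbertPath (U : Set T) (u t : T) (ue : unitInterval → T) : Prop :=
  (∀ ε, ue ε ∈ U) ∧
    (fun ε : unitInterval => ue ε - u - (ε : ℝ) • t) =o[𝓝 (0 : unitInterval)] fun ε => (ε : ℝ)

/-- The tangent set of `U` at `u`. -/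
def hilbertTangentSet (U : Set T) (u : T) : Set T :=
  {t | ∃ ue, IsHilbertPath U u t ue}

/-- The tangent space of `U` at `u`: the closure of the linear span of the tangent set. -/
abbrev hilbertTangentSpace (U : Set T) (u : T) : Submodule ℝ T :=
  (Submodule.span ℝ (hilbertTangentSet U u)).topologicalClosure

theorem mem_modelTangentSpace {M : Set (ProbabilityMeasure Z)} {P : ProbabilityMeasure Z}
    {s : L2 P} (hs : s ∈ modelTangentSet M P) : s ∈ modelTangentSpace M P :=
  Submodule.le_topologicalClosure _ (Submodule.subset_span hs)

theorem mem_hilbertTangentSpace {U : Set T} {u t : T} (ht : t ∈ hilbertTangentSet U u) :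
    t ∈ hilbertTangentSpace U u :=
  Submodule.le_topologicalClosure _ (Submodule.subset_span ht)

/-! ## Total pathwise differentiability -/

/-- The Hilbert space direct sum of the tangent space of `M` at `P` and that of `U` at `u`. -/
abbrev TangentSum (M : Set (ProbabilityMeasure Z)) (P : ProbabilityMeasure Z) (U : Set T) (u : T) :
    Type _ :=
  WithLp 2 (modelTangentSpace M P × hilbertTangentSpace U u)

variable {W : Type*} [NormedAddCommGroup W] [InnerProductSpace ℝ W]

/-- `D` is the differential operator at `(P, u)` of `θ : M × U → W`. Only the values of `θ` on
`M × U` matter. -/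
def IsTotalDifferential (M : Set (ProbabilityMeasure Z)) (U : Set T)
    (θ : ProbabilityMeasure Z → T → W) (P : ProbabilityMeasure Z) (u : T)
    (D : TangentSum M P U u →L[ℝ] W) : Prop :=
  ∀ (s : L2 P) (hs : s ∈ modelTangentSet M P) (t : T) (ht : t ∈ hilbertTangentSet U u)
    (Pe : unitInterval → ProbabilityMeasure Z) (ue : unitInterval → T),
    IsModelPath M P s Pe → IsHilbertPath U u t ue →
    (fun ε : unitInterval => θ (Pe ε) (ue ε) - θ P u
        - (ε : ℝ) • D (WithLp.toLp 2
            (⟨s, mem_modelTangentSpace hs⟩, ⟨t, mem_hilbertTangentSpace ht⟩)))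
      =o[𝓝 (0 : unitInterval)] fun ε => (ε : ℝ)

/-- `θ : M × U → W` is totally pathwise differentiable at `(P, u)`. -/
def TotallyPathwiseDifferentiableAt (M : Set (ProbabilityMeasure Z)) (U : Set T)
    (θ : ProbabilityMeasure Z → T → W) (P : ProbabilityMeasure Z) (u : T) : Prop :=
  ∃ D : TangentSum M P U u →L[ℝ] W, IsTotalDifferential M U θ P u D

open Classical in
/-- The differential operator of `θ` at `(P, u)` (zero if `θ` is not differentiable there). It is
unique by `IsTotalDifferential.unique`. -/
def totalDifferential (M : Set (ProbabilityMeasure Z)) (U : Set T)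
    (θ : ProbabilityMeasure Z → T → W) (P : ProbabilityMeasure Z) (u : T) :
    TangentSum M P U u →L[ℝ] W :=
  if h : TotallyPathwiseDifferentiableAt M U θ P u then h.choose else 0

theorem TotallyPathwiseDifferentiableAt.isTotalDifferential {M : Set (ProbabilityMeasure Z)}
    {U : Set T} {θ : ProbabilityMeasure Z → T → W} {P : ProbabilityMeasure Z} {u : T}
    (h : TotallyPathwiseDifferentiableAt M U θ P u) :
    IsTotalDifferential M U θ P u (totalDifferential M U θ P u) := by
  unfold totalDifferential
  rw [dif_pos h]
  exact h.choose_spec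

theorem isModelPath_const {M : Set (ProbabilityMeasure Z)} {P : ProbabilityMeasure Z}
    (hP : P ∈ M) : IsModelPath M P 0 (fun _ => P) := by
  refine ⟨fun _ => hP, rfl, ?_⟩
  refine (isLittleO_zero _ _).congr_left fun ε => ?_
  symm
  simp

theorem isHilbertPath_const {U : Set T} {u : T} (hu : u ∈ U) :
    IsHilbertPath U u 0 (fun _ => u) := by
  refine ⟨fun _ => hu, ?_⟩
  simp

/-- A continuous linear map on the closed span of a set vanishes if it vanishes on the set. -/
theorem clm_closure_span_eq_zero {E F : Type*} [NormedAddCommGroup E] [NormedSpace ℝ E]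
    [NormedAddCommGroup F] [NormedSpace ℝ F] {A : Set E}
    (L : (Submodule.span ℝ A).topologicalClosure →L[ℝ] F)
    (h : ∀ x (hx : x ∈ (Submodule.span ℝ A).topologicalClosure), x ∈ A → L ⟨x, hx⟩ = 0)
    (x : (Submodule.span ℝ A).topologicalClosure) : L x = 0 := by
  let K : Submodule ℝ E := (LinearMap.ker L.toLinearMap).map
    (Submodule.span ℝ A).topologicalClosure.subtype
  have hK : IsClosed (K : Set E) := by
    have h1 : IsClosed ((LinearMap.ker L.toLinearMap :
        Submodule ℝ (Submodule.span ℝ A).topologicalClosure) :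
        Set (Submodule.span ℝ A).topologicalClosure) := L.isClosed_ker
    exact ((Submodule.isClosed_topologicalClosure _).isClosedEmbedding_subtypeVal.isClosedMap) _ h1
  have hA : A ⊆ K := fun y hy =>
    ⟨⟨y, Submodule.le_topologicalClosure _ (Submodule.subset_span hy)⟩, h y _ hy, rfl⟩
  have hle : (Submodule.span ℝ A).topologicalClosure ≤ K :=
    Submodule.topologicalClosure_minimal _ (Submodule.span_le.2 hA) hK
  obtain ⟨y, hy, hyx⟩ := hle x.2
  have : y = x := Subtype.ext hyx
  rw [← this]
  exact hy

theorem eq_zero_of_smul_isLittleO {F : Type*} [NormedAddCommGroup F] [NormedSpace ℝ F] {w : F}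
    (h : (fun ε : unitInterval => (ε : ℝ) • w) =o[𝓝 (0 : unitInterval)] fun ε => (ε : ℝ)) :
    w = 0 := by
  by_contra hw
  have hw' : 0 < ‖w‖ := norm_pos_iff.2 hw
  have h1 := (isLittleO_iff.1 h) (half_pos hw')
  have h2 : ∃ᶠ ε in 𝓝 (0 : unitInterval), ε ≠ 0 := by
    have : (𝓝[≠] (0 : unitInterval)).NeBot := inferInstance
    exact frequently_mem_iff_neBot.2 this
  obtain ⟨ε, hne, hε⟩ := (h2.and_eventually h1).exists
  have hpos : 0 < ‖(ε : ℝ)‖ := norm_pos_iff.2 fun h0 => hne (Subtype.ext h0)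
  rw [norm_smul] at hε
  nlinarith [mul_pos hpos hw']

/-- The differential operator is unique. -/
theorem IsTotalDifferential.unique {M : Set (ProbabilityMeasure Z)} {U : Set T}
    {θ : ProbabilityMeasure Z → T → W} {P : ProbabilityMeasure Z} {u : T} (hP : P ∈ M)
    (hu : u ∈ U) {D₁ D₂ : TangentSum M P U u →L[ℝ] W} (h₁ : IsTotalDifferential M U θ P u D₁)
    (h₂ : IsTotalDifferential M U θ P u D₂) : D₁ = D₂ := by
  have key : ∀ (s : L2 P) (hs : s ∈ modelTangentSet M P) (t : T)
      (ht : t ∈ hilbertTangentSet U u),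
      (D₁ - D₂) (WithLp.toLp 2
        (⟨s, mem_modelTangentSpace hs⟩, ⟨t, mem_hilbertTangentSpace ht⟩)) = 0 := by
    intro s hs t ht
    obtain ⟨Pe, hPe⟩ := id hs
    obtain ⟨ue, hue⟩ := id ht
    refine eq_zero_of_smul_isLittleO ?_
    refine ((h₂ s hs t ht Pe ue hPe hue).sub (h₁ s hs t ht Pe ue hPe hue)).congr_left ?_
    intro ε
    rw [_root_.sub_apply, smul_sub]
    abel
  have z1 : (0 : L2 P) ∈ modelTangentSet M P := ⟨_, isModelPath_const hP⟩
  have z2 : (0 : T) ∈ hilbertTangentSet U u := ⟨_, isHilbertPath_const hu⟩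
  let e := (WithLp.prodContinuousLinearEquiv 2 ℝ (modelTangentSpace M P)
    (hilbertTangentSpace U u)).symm
  let L : (modelTangentSpace M P × hilbertTangentSpace U u) →L[ℝ] W :=
    (D₁ - D₂).comp e.toContinuousLinearMap
  have hL1 : ∀ x, L (x, 0) = 0 := clm_closure_span_eq_zero
    (L.comp (ContinuousLinearMap.inl ℝ _ _)) fun x _ hx => key x hx 0 z2
  have hL2 : ∀ y, L (0, y) = 0 := clm_closure_span_eq_zero
    (L.comp (ContinuousLinearMap.inr ℝ _ _)) fun y _ hy => key 0 z1 y hy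
  have hL : ∀ x y, L (x, y) = 0 := fun x y => by
    have : ((x, y) : modelTangentSpace M P × hilbertTangentSpace U u) = (x, 0) + (0, y) := by simp
    rw [this, map_add, hL1, hL2, add_zero]
  ext x
  have := hL x.fst x.snd
  exact sub_eq_zero.1 this

end Paths

/-! ## The parameter as a composition of primitives -/

section Program

variable {Z : Type*} [MeasurableSpace Z] {n : ℕ} {W : Fin (n + 1) → Type*}
  [∀ j, NormedAddCommGroup (W j)] [∀ j, InnerProductSpace ℝ (W j)]

/-- An expression of a parameter on the model `M` as a composition of `k = n + 1` primitives
`θ_j : M × U_j → V_j`, where `V_j ⊆ W_j` and `∏_{i ∈ pa(j)} V_i ⊆ U_j ⊆ ⨁_{i ∈ pa(j)} W_i`. The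
indices `1, …, k` are the elements of `Fin (n + 1)`. Only the values of `θ j` on `M × U j` matter.
If `pa j` is empty, the direct sum is the zero space and `U j = {0}`. -/
structure Program (M : Set (ProbabilityMeasure Z)) (W : Fin (n + 1) → Type*)
    [∀ j, NormedAddCommGroup (W j)] [∀ j, InnerProductSpace ℝ (W j)] where
  pa : Fin (n + 1) → Finset (Fin (n + 1))
  pa_lt : ∀ j, ∀ i ∈ pa j, i < j
  V : ∀ j, Set (W j)
  U : ∀ j, Set (PiLp 2 fun i : pa j => W i)
  prod_subset : ∀ j (u : PiLp 2 fun i : pa j => W i), (∀ i : pa j, u i ∈ V i) → u ∈ U j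
  θ : ∀ j, ProbabilityMeasure Z → (PiLp 2 fun i : pa j => W i) → W j
  mapsTo : ∀ j, ∀ P ∈ M, ∀ u ∈ U j, θ j P u ∈ V j

namespace Program

variable {M : Set (ProbabilityMeasure Z)} (S : Program M W)

/-- The forward pass `h_j = θ_j(Q_j, h_{pa(j)})`, in which the `j`-th primitive is evaluated at its
own distribution `Q_j`. -/
def forward (Q : Fin (n + 1) → ProbabilityMeasure Z) (j : Fin (n + 1)) : W j :=
  S.θ j (Q j) (WithLp.toLp 2 fun i : S.pa j => forward Q i)
termination_by j
decreasing_by exact S.pa_lt j i i.2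

/-- `h_{pa(j)} = (h_i)_{i ∈ pa(j)}`. -/
def forwardPa (Q : Fin (n + 1) → ProbabilityMeasure Z) (j : Fin (n + 1)) :
    PiLp 2 fun i : S.pa j => W i :=
  WithLp.toLp 2 fun i : S.pa j => S.forward Q i

theorem forward_eq (Q : Fin (n + 1) → ProbabilityMeasure Z) (j : Fin (n + 1)) :
    S.forward Q j = S.θ j (Q j) (S.forwardPa Q j) := by
  rw [forward, forwardPa]

/-- The value at `P` of the parameter: all primitives are evaluated at the same distribution `P`,
and the last entry of the forward pass is returned. -/
def eval (P : ProbabilityMeasure Z) : W (Fin.last n) :=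
  S.forward (fun _ => P) (Fin.last n)

/-- The direct sum `L²(P) ⊕ (⨁_{i ∈ pa(j)} W_i)`. -/
abbrev AugSpace (P : ProbabilityMeasure Z) (j : Fin (n + 1)) : Type _ :=
  WithLp 2 (L2 P × PiLp 2 fun i : S.pa j => W i)

variable [∀ j, CompleteSpace (W j)]

/-- `θ̇_{j,Q_j,h_{pa(j)}}^*(w)`: the Hermitian adjoint of the differential operator of `θ_j` at
`(Q_j, h_{pa(j)})`, applied to `w`, as an element of the ambient direct sum. -/
def adjoint (Q : Fin (n + 1) → ProbabilityMeasure Z) (j : Fin (n + 1)) (w : W j) :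
    S.AugSpace (Q j) j :=
  let a := ContinuousLinearMap.adjoint
    (totalDifferential M (S.U j) (S.θ j) (Q j) (S.forwardPa Q j)) w
  WithLp.toLp 2 ((a.fst : L2 (Q j)), (a.snd : PiLp 2 fun i : S.pa j => W i))

/-- One step of the backward pass: `(f_0, f_{pa(j)}) += ϑ`. -/
def augment (Q : Fin (n + 1) → ProbabilityMeasure Z) (j : Fin (n + 1))
    (ϑ : S.AugSpace (Q j) j) (f : (Z → ℝ) × (∀ i, W i)) : (Z → ℝ) × (∀ i, W i) :=
  (fun z => f.1 z + ϑ.fst z,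
    fun i => if hi : i ∈ S.pa j then f.2 i + ϑ.snd ⟨i, hi⟩ else f.2 i)

/-- The variables `(f_0, (f_1, …, f_k))` of the backward pass after its first `m` steps, that is
after the steps `j = k, k - 1, …, k - m + 1`. Step `j` augments `(f_0, f_{pa(j)})` by
`ϑ_j = θ̇_{j,Q_j,h_{pa(j)}}^*(f_j) + δ_j`. The initial values are zero, except that `f_k = fk`. -/
def backward (Q : Fin (n + 1) → ProbabilityMeasure Z) (δ : ∀ j, S.AugSpace (Q j) j)
    (fk : W (Fin.last n)) : ℕ → (Z → ℝ) × (∀ i, W i)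
  | 0 => (fun _ => 0, Pi.single (Fin.last n) fk)
  | m + 1 =>
    let f := backward Q δ fk m
    if hm : m < n + 1 then
      let j : Fin (n + 1) := Fin.rev ⟨m, hm⟩
      S.augment Q j (S.adjoint Q j (f.2 j) + δ j) f
    else f

/-- `ϑ_j = θ̇_{j,Q_j,h_{pa(j)}}^*(f_j) + δ_j`, with `f_j` the value just before step `j` of the
backward pass, which is preceded by `k - j` steps. -/
def vartheta (Q : Fin (n + 1) → ProbabilityMeasure Z) (δ : ∀ j, S.AugSpace (Q j) j)
    (fk : W (Fin.last n)) (j : Fin (n + 1)) : S.AugSpace (Q j) j :=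
  S.adjoint Q j ((S.backward Q δ fk (Fin.rev j)).2 j) + δ j

/-- The output `f_0` of the backward pass, after all its `k = n + 1` steps. -/
def influence (Q : Fin (n + 1) → ProbabilityMeasure Z) (δ : ∀ j, S.AugSpace (Q j) j)
    (fk : W (Fin.last n)) : Z → ℝ :=
  (S.backward Q δ fk (n + 1)).1

end Program

end Program

end

end AutoDiff

open AutoDiff

/-! Two first-order expansions cancel. Forward mode: the perturbed forward pass is differentiable
along the submodels, so the last value moves from `ψ P` by `ε t_k + o(ε)`, where the derivatives
`t_j` obey the chain rule through the differentials at `ε = 0` (`exists_forward_derivative`).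
Reverse mode: as `δ 0 = 0`, the backward pass at `ε = 0` is exact, and moving adjoints across inner
products gives `∑ j ⟨ϑ_{j,0,0}, s_j⟩ = t_k` (`sum_inner_vartheta`).

For `ε > 0` the only exact fact needed is that `ϑ_{j,ε,0}` has mean zero under `P_{j,ε}`
(`integral_vartheta_fst`): elements of the tangent space are centered, and so are the errors. Its
integral under `P` is therefore minus the change of integral from `P` to `P_{j,ε}`. Quadratic mean
differentiability, boundedness and `L²(P)` convergence identify this change as `ε ⟨ϑ_{j,0,0}, s_j⟩ +
o(ε)` (`IsModelPath.integral_sub_integral_isLittleO`). Summing over `j` removes the linear term,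
whatever the rate at which the errors vanish. -/

namespace AutoDiff

noncomputable section

/-! ### Integrals of bounded functions along smooth submodels -/

section Scores

variable {Z : Type*} [MeasurableSpace Z]

/-- The remainder of the expansion of the root density of `Q` at `P` in the direction `s`. -/
def rootRemainder (P : ProbabilityMeasure Z) (s : L2 P) (ε : ℝ) (Q : ProbabilityMeasure Z)
    (z : Z) : ℝ :=
  √(density Q ((P : Measure Z) + (Q : Measure Z)) z)
    - √(density P ((P : Measure Z) + (Q : Measure Z)) z)
    - ε * s z * √(density P ((P : Measure Z) + (Q : Measure Z)) z) / 2

theorem density_nonneg (Q : ProbabilityMeasure Z) (ν : Measure Z) (z : Z) : 0 ≤ density Q ν z :=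
  ENNReal.toReal_nonneg

theorem measurable_density (Q : ProbabilityMeasure Z) (ν : Measure Z) :
    Measurable (density Q ν) :=
  (Measure.measurable_rnDeriv _ _).ennreal_toReal

theorem integral_density_mul {Q : ProbabilityMeasure Z} {ν : Measure Z} [IsFiniteMeasure ν]
    (h : (Q : Measure Z) ≪ ν) (f : Z → ℝ) :
    ∫ z, density Q ν z * f z ∂ν = ∫ z, f z ∂(Q : Measure Z) :=
  integral_rnDeriv_smul h

theorem integrable_density_mul {Q : ProbabilityMeasure Z} {ν : Measure Z} [IsFiniteMeasure ν]
    (h : (Q : Measure Z) ≪ ν) {f : Z → ℝ} (hf : Integrable f (Q : Measure Z)) :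
    Integrable (fun z => density Q ν z * f z) ν :=
  (integrable_rnDeriv_smul_iff h).2 hf

theorem integrable_sq_L2 {P : ProbabilityMeasure Z} (s : L2 P) :
    Integrable (fun z => s z ^ 2) (P : Measure Z) :=
  (memLp_two_iff_integrable_sq (Lp.aestronglyMeasurable s)).1 (Lp.memLp s)

theorem memLp_mul_sqrt_density {Q : ProbabilityMeasure Z} {ν : Measure Z} [IsFiniteMeasure ν]
    (h : (Q : Measure Z) ≪ ν) {f : Z → ℝ} (hfm : StronglyMeasurable f)
    (hf : Integrable (fun z => f z ^ 2) (Q : Measure Z)) :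
    MemLp (fun z => f z * √(density Q ν z)) 2 ν := by
  have hm : AEStronglyMeasurable (fun z => f z * √(density Q ν z)) ν :=
    (hfm.mul (measurable_density Q ν).sqrt.stronglyMeasurable).aestronglyMeasurable
  rw [memLp_two_iff_integrable_sq hm]
  refine (integrable_density_mul h hf).congr (ae_of_all _ fun z => ?_)
  simp only [mul_pow, Real.sq_sqrt (density_nonneg Q ν z)]
  ring

theorem integral_mul_le_sqrt_mul_sqrt {ν : Measure Z} {f g : Z → ℝ} (hf0 : ∀ z, 0 ≤ f z)
    (hg0 : ∀ z, 0 ≤ g z) (hf : MemLp f 2 ν) (hg : MemLp g 2 ν) :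
    ∫ z, f z * g z ∂ν ≤ √(∫ z, f z ^ 2 ∂ν) * √(∫ z, g z ^ 2 ∂ν) := by
  have := integral_mul_le_Lp_mul_Lq_of_nonneg (μ := ν) Real.HolderConjugate.two_two
    (ae_of_all _ hf0) (ae_of_all _ hg0) (by simpa using hf) (by simpa using hg)
  simpa [Real.sqrt_eq_rpow] using this

/-- A quantitative expansion of the integral of a bounded function along a smooth submodel. -/
theorem abs_integral_sub_integral_sub_le (P Q : ProbabilityMeasure Z) (s : L2 P) (ε : ℝ)
    {g : Z → ℝ} (hg : StronglyMeasurable g) {c : ℝ} (hP : ∀ᵐ z ∂(P : Measure Z), |g z| ≤ c)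
    (hQ : ∀ᵐ z ∂(Q : Measure Z), |g z| ≤ c) :
    |∫ z, g z ∂(Q : Measure Z) - ∫ z, g z ∂(P : Measure Z)
        - ε * ∫ z, g z * s z ∂(P : Measure Z)|
      ≤ c * (2 * ∫ z, rootRemainder P s ε Q z ^ 2 ∂((P : Measure Z) + (Q : Measure Z))
        + ε ^ 2 / 2 * ∫ z, s z ^ 2 ∂(P : Measure Z)
        + 2 * √(∫ z, rootRemainder P s ε Q z ^ 2 ∂((P : Measure Z) + (Q : Measure Z)))) := by
  set ν : Measure Z := (P : Measure Z) + (Q : Measure Z) with hν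
  have hPν : (P : Measure Z) ≪ ν := (Measure.le_add_right le_rfl).absolutelyContinuous
  have hQν : (Q : Measure Z) ≪ ν := (Measure.le_add_left le_rfl).absolutelyContinuous
  have hc : 0 ≤ c := by
    obtain ⟨z, hz⟩ := hP.exists
    exact (abs_nonneg _).trans hz
  have hgν : ∀ᵐ z ∂ν, |g z| ≤ c := ae_add_measure_iff.2 ⟨hP, hQ⟩
  have hs := integrable_sq_L2 s
  have hsm : StronglyMeasurable (s : Z → ℝ) := Lp.stronglyMeasurable s
  have hgP : Integrable g (P : Measure Z) := Integrable.of_bound hg.aestronglyMeasurable c hP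
  have hgQ : Integrable g (Q : Measure Z) := Integrable.of_bound hg.aestronglyMeasurable c hQ
  have hsP : Integrable (s : Z → ℝ) (P : Measure Z) := (Lp.memLp s).integrable (by norm_num)
  have hgs : Integrable (fun z => g z * s z) (P : Measure Z) :=
    hsP.bdd_mul hg.aestronglyMeasurable hP
  have h1P : MemLp (fun z => √(density P ν z)) 2 ν := by
    simpa using memLp_mul_sqrt_density hPν (f := fun _ => 1) stronglyMeasurable_const (by simp)
  have h1Q : MemLp (fun z => √(density Q ν z)) 2 ν := by
    simpa using memLp_mul_sqrt_density hQν (f := fun _ => 1) stronglyMeasurable_const (by simp)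
  have hsL := memLp_mul_sqrt_density hPν hsm hs
  have hr : MemLp (rootRemainder P s ε Q) 2 ν := by
    have := (h1Q.sub h1P).sub (hsL.const_mul (ε / 2))
    refine this.ae_eq (ae_of_all _ fun z => ?_)
    simp only [Pi.sub_apply, rootRemainder, ← hν]
    ring
  have hr2 : Integrable (fun z => rootRemainder P s ε Q z ^ 2) ν := hr.integrable_sq
  have hra : MemLp (fun z => |rootRemainder P s ε Q z|) 2 ν := hr.abs
  have hdom1 : Integrable (fun z => density P ν z * s z ^ 2) ν := integrable_density_mul hPν hs
  have hdom2 : Integrable (fun z => √(density P ν z) * |rootRemainder P s ε Q z|) ν :=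
    h1P.integrable_mul hra
  have hdiff : Integrable (fun z => density Q ν z * g z - density P ν z * g z) ν :=
    (integrable_density_mul hQν hgQ).sub (integrable_density_mul hPν hgP)
  have hsum : Integrable (fun z => 2 * rootRemainder P s ε Q z ^ 2
      + ε ^ 2 / 2 * (density P ν z * s z ^ 2)) ν :=
    (hr2.const_mul 2).add (hdom1.const_mul _)
  -- Cauchy–Schwarz, the root density of `P` being a unit vector of `L²(ν)`.
  have hcs : ∫ z, √(density P ν z) * |rootRemainder P s ε Q z| ∂ν
      ≤ √(∫ z, rootRemainder P s ε Q z ^ 2 ∂ν) := by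
    have := integral_mul_le_sqrt_mul_sqrt (fun z => Real.sqrt_nonneg (density P ν z))
      (fun z => abs_nonneg (rootRemainder P s ε Q z)) h1P hra
    have h1 : ∫ z, √(density P ν z) ^ 2 ∂ν = 1 := by
      have := integral_density_mul hPν (fun _ => 1)
      simp only [mul_one, integral_const, probReal_univ, smul_eq_mul] at this
      rw [← this]
      exact integral_congr_ae (ae_of_all _ fun z => Real.sq_sqrt (density_nonneg P ν z))
    simpa [h1, sq_abs] using this
  rw [← integral_density_mul hPν g, ← integral_density_mul hQν g,
    ← integral_density_mul hPν (fun z => g z * s z), ← integral_density_mul hPν (fun z => s z ^ 2),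
    ← integral_const_mul, ← integral_sub (integrable_density_mul hQν hgQ)
      (integrable_density_mul hPν hgP)]
  rw [← integral_sub hdiff ((integrable_density_mul hPν hgs).const_mul ε)]
  have hbound : ∀ᵐ z ∂ν, ‖density Q ν z * g z - density P ν z * g z
      - ε * (density P ν z * (g z * s z))‖ ≤
      c * (2 * rootRemainder P s ε Q z ^ 2 + ε ^ 2 / 2 * (density P ν z * s z ^ 2)
        + 2 * (√(density P ν z) * |rootRemainder P s ε Q z|)) := by
    filter_upwards [hgν] with z hz
    have hp := Real.sq_sqrt (density_nonneg P ν z)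
    have hq := Real.sq_sqrt (density_nonneg Q ν z)
    have hp0 := Real.sqrt_nonneg (density P ν z)
    have hrd : rootRemainder P s ε Q z = √(density Q ν z) - √(density P ν z)
      - ε * s z * √(density P ν z) / 2 := rfl
    set p := √(density P ν z)
    set q := √(density Q ν z)
    set r := rootRemainder P s ε Q z
    rw [← hp, ← hq]
    -- Squaring this expansion of the root density produces the linear term `ε s p²`; what remains
    -- is a square and the cross term `2 p r`. The square is at most `2 r² + ε² s² p² / 2` by `(a +
    -- b)² ≤ 2 a² + 2 b²`.
    have hqe : q = p + ε * s z * p / 2 + r := by linarith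
    have heq : q ^ 2 * g z - p ^ 2 * g z - ε * (p ^ 2 * (g z * s z))
        = g z * ((ε * s z * p / 2 + r) ^ 2 + 2 * (p * r)) := by
      rw [hqe]; ring
    rw [heq, Real.norm_eq_abs, abs_mul]
    refine mul_le_mul hz ?_ (abs_nonneg _) hc
    refine (abs_add_le _ _).trans ?_
    rw [abs_of_nonneg (sq_nonneg _), abs_mul, abs_mul, abs_of_nonneg hp0, abs_two]
    nlinarith [sq_nonneg (ε * s z * p / 2 - r)]
  have hint : Integrable (fun z => c * (2 * rootRemainder P s ε Q z ^ 2
      + ε ^ 2 / 2 * (density P ν z * s z ^ 2)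
        + 2 * (√(density P ν z) * |rootRemainder P s ε Q z|))) ν :=
    (hsum.add (hdom2.const_mul 2)).const_mul c
  refine (norm_integral_le_of_norm_le hint hbound).trans ?_
  rw [integral_const_mul, integral_add hsum (hdom2.const_mul 2), integral_add (hr2.const_mul 2) (hdom1.const_mul _), integral_const_mul,
    integral_const_mul, integral_const_mul]
  gcongr

/-- By Hölder, the `L¹` distance of the products is at most the `L²` distance of the `g i` from `g₀`
times the norm of `s`. -/
theorem tendsto_integral_mul_of_eLpNorm {ι : Type*} {l : Filter ι} {P : ProbabilityMeasure Z}
    (s : L2 P) {g : ι → Z → ℝ} {g₀ : Z → ℝ} (hg : ∀ᶠ i in l, MemLp (g i) 2 (P : Measure Z))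
    (hg₀ : MemLp g₀ 2 (P : Measure Z))
    (h : Tendsto (fun i => eLpNorm (fun z => g i z - g₀ z) 2 (P : Measure Z)) l (𝓝 0)) :
    Tendsto (fun i => ∫ z, g i z * s z ∂(P : Measure Z)) l
      (𝓝 (∫ z, g₀ z * s z ∂(P : Measure Z))) := by
  refine tendsto_integral_of_L1' _ (hg₀.integrable_mul (Lp.memLp s)).aestronglyMeasurable ?_ ?_
  · exact hg.mono fun i hi => hi.integrable_mul (Lp.memLp s)
  have hlim : Tendsto (fun i => eLpNorm (fun z => g i z - g₀ z) 2 (P : Measure Z)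
      * eLpNorm s 2 (P : Measure Z)) l (𝓝 0) := by
    simpa using ENNReal.Tendsto.mul_const h (Or.inr (Lp.memLp s).eLpNorm_ne_top)
  refine tendsto_of_tendsto_of_tendsto_of_le_of_le' tendsto_const_nhds hlim
    (Eventually.of_forall fun _ => zero_le) (hg.mono fun i hi => ?_)
  have := eLpNorm_smul_le_mul_eLpNorm (p := 2) (q := 2) (r := 1) (Lp.aestronglyMeasurable s)
    (hi.sub hg₀).aestronglyMeasurable
  refine le_trans (le_of_eq ?_) this
  congr 1
  ext z
  simp [sub_mul]

/-- The expansion of the integrals of bounded, `L²(P)`-convergent functions along a smooth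
submodel. -/
theorem IsModelPath.integral_sub_integral_isLittleO {M : Set (ProbabilityMeasure Z)}
    {P : ProbabilityMeasure Z} {s : L2 P} {Pe : unitInterval → ProbabilityMeasure Z}
    (h : IsModelPath M P s Pe) {g : unitInterval → Z → ℝ} (hg : ∀ ε, StronglyMeasurable (g ε))
    {c : ℝ} (hP : ∀ᶠ ε in 𝓝 (0 : unitInterval), ∀ᵐ z ∂(P : Measure Z), |g ε z| ≤ c)
    (hQ : ∀ᶠ ε in 𝓝 (0 : unitInterval), ∀ᵐ z ∂(Pe ε : Measure Z), |g ε z| ≤ c)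
    (hconv : Tendsto (fun ε => eLpNorm (fun z => g ε z - g 0 z) 2 (P : Measure Z))
      (𝓝 (0 : unitInterval)) (𝓝 0)) :
    (fun ε : unitInterval => ∫ z, g ε z ∂(Pe ε : Measure Z) - ∫ z, g ε z ∂(P : Measure Z)
        - (ε : ℝ) * ∫ z, g 0 z * s z ∂(P : Measure Z))
      =o[𝓝 (0 : unitInterval)] fun ε => (ε : ℝ) := by
  have hmem : ∀ᶠ ε in 𝓝 (0 : unitInterval), MemLp (g ε) 2 (P : Measure Z) :=
    hP.mono fun ε hε => MemLp.of_bound (hg ε).aestronglyMeasurable c hε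
  have hlim := tendsto_integral_mul_of_eLpNorm s hmem hmem.self_of_nhds hconv
  -- Freezing `g ε` at `g 0` inside the linear term costs `ε · o(1)`; no rate of convergence is
  -- needed.
  have h1 : (fun ε : unitInterval => (ε : ℝ) * (∫ z, g ε z * s z ∂(P : Measure Z)
      - ∫ z, g 0 z * s z ∂(P : Measure Z))) =o[𝓝 (0 : unitInterval)] fun ε => (ε : ℝ) := by
    have : (fun ε : unitInterval => ∫ z, g ε z * s z ∂(P : Measure Z)
      - ∫ z, g 0 z * s z ∂(P : Measure Z)) =o[𝓝 (0 : unitInterval)] fun _ => (1 : ℝ) := by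
      rw [isLittleO_one_iff]
      simpa using hlim.sub_const (∫ z, g 0 z * s z ∂(P : Measure Z))
    simpa using (isBigO_refl (fun ε : unitInterval => (ε : ℝ)) (𝓝 0)).mul_isLittleO this
  have hid : Tendsto (fun ε : unitInterval => (ε : ℝ)) (𝓝 0) (𝓝 0) :=
    continuous_subtype_val.tendsto' 0 0 rfl
  have hsq : (fun ε : unitInterval => (ε : ℝ) ^ 2) =o[𝓝 (0 : unitInterval)]
      fun ε => (ε : ℝ) := by
    simpa [pow_two] using ((isLittleO_one_iff ℝ).2 hid).mul_isBigO
      (isBigO_refl (fun ε : unitInterval => (ε : ℝ)) (𝓝 0))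
  have hR : (fun ε : unitInterval => ∫ z, rootRemainder P s ε (Pe ε) z ^ 2
      ∂((P : Measure Z) + (Pe ε : Measure Z))) =o[𝓝 (0 : unitInterval)]
      fun ε => (ε : ℝ) ^ 2 := h.2.2
  have hsqrt : (fun ε : unitInterval => √(∫ z, rootRemainder P s ε (Pe ε) z ^ 2
      ∂((P : Measure Z) + (Pe ε : Measure Z)))) =o[𝓝 (0 : unitInterval)]
      fun ε => (ε : ℝ) := by
    -- The cross term enters through the square root of the remainder, so the rate `o(ε²)` is just
    -- enough.
    refine IsLittleO.of_pow (n := 2) ?_ two_ne_zero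
    refine hR.congr_left fun ε => ?_
    exact (Real.sq_sqrt (integral_nonneg fun z => sq_nonneg _)).symm
  have hB : (fun ε : unitInterval => c * (2 * ∫ z, rootRemainder P s ε (Pe ε) z ^ 2
      ∂((P : Measure Z) + (Pe ε : Measure Z)) + (ε : ℝ) ^ 2 / 2 * ∫ z, s z ^ 2 ∂(P : Measure Z)
        + 2 * √(∫ z, rootRemainder P s ε (Pe ε) z ^ 2
          ∂((P : Measure Z) + (Pe ε : Measure Z))))) =o[𝓝 (0 : unitInterval)]
      fun ε => (ε : ℝ) := by
    refine IsLittleO.const_mul_left (((hR.trans hsq).const_mul_left 2).add ?_ |>.add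
      (hsqrt.const_mul_left 2)) c
    refine (hsq.const_mul_left ((∫ z, s z ^ 2 ∂(P : Measure Z)) / 2)).congr_left fun ε => ?_
    ring
  have h2 : (fun ε : unitInterval => ∫ z, g ε z ∂(Pe ε : Measure Z) - ∫ z, g ε z ∂(P : Measure Z)
        - (ε : ℝ) * ∫ z, g ε z * s z ∂(P : Measure Z))
      =o[𝓝 (0 : unitInterval)] fun ε => (ε : ℝ) := by
    refine IsBigO.trans_isLittleO (IsBigO.of_bound 1 ?_) hB
    filter_upwards [hP, hQ] with ε h₁ h₂
    rw [one_mul]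
    exact (abs_integral_sub_integral_sub_le P (Pe ε) s ε (hg ε) h₁ h₂).trans (le_abs_self _)
  refine (h2.add h1).congr_left fun ε => ?_
  ring

/-- Expanding the constant function `1`, whose integral never changes, leaves `ε ∫ s = o(ε)`. -/
theorem integral_eq_zero_of_mem_modelTangentSet {M : Set (ProbabilityMeasure Z)}
    {P : ProbabilityMeasure Z} {s : L2 P} (hs : s ∈ modelTangentSet M P) :
    ∫ z, s z ∂(P : Measure Z) = 0 := by
  obtain ⟨Pe, h⟩ := hs
  have := h.integral_sub_integral_isLittleO (g := fun _ _ => 1) (c := 1)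
    (fun _ => stronglyMeasurable_const) (by simp) (by simp) (by simp)
  refine eq_zero_of_smul_isLittleO (this.neg_left.congr_left fun ε => ?_)
  simp

/-- Integration is the inner product with the constant `1`, hence continuous and linear, so its
vanishing on scores passes to their closed span. -/
theorem integral_eq_zero_of_mem_modelTangentSpace {M : Set (ProbabilityMeasure Z)}
    {P : ProbabilityMeasure Z} {s : L2 P} (hs : s ∈ modelTangentSpace M P) :
    ∫ z, s z ∂(P : Measure Z) = 0 := by
  let o : L2 P := indicatorConstLp 2 MeasurableSet.univ (measure_ne_top _ _) (1 : ℝ)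
  have ho : ∀ f : L2 P, inner ℝ o f = ∫ z, f z ∂(P : Measure Z) := fun f => by
    simp only [o]
    rw [L2.inner_indicatorConstLp_one, setIntegral_univ]
  rw [← ho]
  exact congrArg (fun L => L) (clm_closure_span_eq_zero
    ((innerSL ℝ o).comp (modelTangentSpace M P).subtypeL)
    (fun x _ hx => by simpa [ho] using integral_eq_zero_of_mem_modelTangentSet hx) ⟨s, hs⟩)

end Scores

/-! ### Differentiating the forward pass -/

namespace Program

variable {Z : Type*} [MeasurableSpace Z] {n : ℕ} {W : Fin (n + 1) → Type*}
  [∀ j, NormedAddCommGroup (W j)] [∀ j, InnerProductSpace ℝ (W j)]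
  {M : Set (ProbabilityMeasure Z)} (S : Program M W)

theorem forward_mem {Q : Fin (n + 1) → ProbabilityMeasure Z} (hQ : ∀ j, Q j ∈ M)
    (j : Fin (n + 1)) : S.forward Q j ∈ S.V j := by
  induction j using WellFoundedLT.induction with
  | ind j ih =>
    rw [forward_eq]
    exact S.mapsTo j _ (hQ j) _ (S.prod_subset j _ fun i => ih i (S.pa_lt j i i.2))

theorem forwardPa_mem {Q : Fin (n + 1) → ProbabilityMeasure Z} (hQ : ∀ j, Q j ∈ M)
    (j : Fin (n + 1)) : S.forwardPa Q j ∈ S.U j :=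
  S.prod_subset j _ fun i => S.forward_mem hQ i

variable {Q : unitInterval → Fin (n + 1) → ProbabilityMeasure Z}

/-- Coordinatewise `o(ε)` is `o(ε)` in the sup norm of the finite product, and the passage to the
Hilbert norm is continuous and linear. -/
theorem isHilbertPath_forwardPa (hQ : ∀ ε j, Q ε j ∈ M) (j : Fin (n + 1))
    (t : ∀ i : S.pa j, W i)
    (ht : ∀ i : S.pa j, (fun ε : unitInterval => S.forward (Q ε) i - S.forward (Q 0) i
      - (ε : ℝ) • t i) =o[𝓝 (0 : unitInterval)] fun ε => (ε : ℝ)) :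
    IsHilbertPath (S.U j) (S.forwardPa (Q 0) j) (WithLp.toLp 2 t)
      (fun ε => S.forwardPa (Q ε) j) := by
  refine ⟨fun ε => S.forwardPa_mem (hQ ε) j, ?_⟩
  let L : (∀ i : S.pa j, W i) →L[ℝ] PiLp 2 fun i : S.pa j => W i :=
    (PiLp.continuousLinearEquiv 2 ℝ fun i : S.pa j => W i).symm.toContinuousLinearMap
  exact (L.isBigO_comp _ _).trans_isLittleO (isLittleO_pi.2 ht)

theorem forward_expansion (hdiff : ∀ j, TotallyPathwiseDifferentiableAt M (S.U j) (S.θ j) (Q 0 j)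
      (S.forwardPa (Q 0) j)) {s : ∀ j, L2 (Q 0 j)}
    (hs : ∀ j, IsModelPath M (Q 0 j) (s j) fun ε => Q ε j) (j : Fin (n + 1))
    {t : PiLp 2 fun i : S.pa j => W i}
    (ht : IsHilbertPath (S.U j) (S.forwardPa (Q 0) j) t (fun ε => S.forwardPa (Q ε) j)) :
    (fun ε : unitInterval => S.forward (Q ε) j - S.forward (Q 0) j
      - (ε : ℝ) • totalDifferential M (S.U j) (S.θ j) (Q 0 j) (S.forwardPa (Q 0) j)
        (WithLp.toLp 2 (⟨s j, mem_modelTangentSpace ⟨_, hs j⟩⟩,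
          ⟨t, mem_hilbertTangentSpace ⟨_, ht⟩⟩)))
      =o[𝓝 (0 : unitInterval)] fun ε => (ε : ℝ) := by
  simp only [S.forward_eq]
  exact (hdiff j).isTotalDifferential _ ⟨_, hs j⟩ _ ⟨_, ht⟩ _ _ (hs j) ht

/-- Forward-mode differentiation: the forward pass is differentiable along smooth submodels, and
its derivatives are propagated by the differential operators of the primitives. -/
theorem exists_forward_derivative
    (hdiff : ∀ j, TotallyPathwiseDifferentiableAt M (S.U j) (S.θ j) (Q 0 j)
      (S.forwardPa (Q 0) j)) {s : ∀ j, L2 (Q 0 j)}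
    (hs : ∀ j, IsModelPath M (Q 0 j) (s j) fun ε => Q ε j) :
    ∃ t : ∀ j, W j, ∀ j, (fun ε : unitInterval => S.forward (Q ε) j - S.forward (Q 0) j
      - (ε : ℝ) • t j) =o[𝓝 (0 : unitInterval)] (fun ε => (ε : ℝ)) ∧
      ∃ (hsj : s j ∈ modelTangentSpace M (Q 0 j))
        (htj : (WithLp.toLp 2 fun i : S.pa j => t i)
          ∈ hilbertTangentSpace (S.U j) (S.forwardPa (Q 0) j)),
        t j = totalDifferential M (S.U j) (S.θ j) (Q 0 j) (S.forwardPa (Q 0) j)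
          (WithLp.toLp 2 (⟨s j, hsj⟩, ⟨_, htj⟩)) := by
  have hQ : ∀ ε j, Q ε j ∈ M := fun ε j => (hs j).1 ε
  have hex : ∀ j, ∃ t : W j, (fun ε : unitInterval => S.forward (Q ε) j - S.forward (Q 0) j
      - (ε : ℝ) • t) =o[𝓝 (0 : unitInterval)] (fun ε => (ε : ℝ)) := by
    intro j
    induction j using WellFoundedLT.induction with
    | ind j ih =>
      choose t ht using fun i : S.pa j => ih i (S.pa_lt j i i.2)
      exact ⟨_, S.forward_expansion hdiff hs j (S.isHilbertPath_forwardPa hQ j t ht)⟩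
  choose t ht using hex
  refine ⟨t, fun j => ⟨ht j, ?_⟩⟩
  have hpath := S.isHilbertPath_forwardPa hQ j (fun i => t i) (fun i => ht i)
  refine ⟨mem_modelTangentSpace ⟨_, hs j⟩, mem_hilbertTangentSpace ⟨_, hpath⟩, ?_⟩
  -- The induction chose derivatives of the parents separately for each `j`, so the family `t` does
  -- not satisfy the recursion by construction. It follows from uniqueness: `t j` and the propagated
  -- value are both first-order derivatives of the same path.
  refine sub_eq_zero.1 (eq_zero_of_smul_isLittleO
    (((S.forward_expansion hdiff hs j hpath).sub (ht j)).congr_left fun ε => ?_))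
  rw [smul_sub]
  abel

/-! ### Adjoints and the backward pass -/

variable [∀ j, CompleteSpace (W j)]

/-- The tangent spaces carry the ambient inner products, so the adjoint identity can be read in the
ambient sum, though only against tangent vectors. -/
theorem inner_adjoint (Q : Fin (n + 1) → ProbabilityMeasure Z) (j : Fin (n + 1)) (w : W j)
    (x : TangentSum M (Q j) (S.U j) (S.forwardPa Q j)) :
    inner ℝ (S.adjoint Q j w).fst (x.fst : L2 (Q j))
      + inner ℝ (S.adjoint Q j w).snd (x.snd : PiLp 2 fun i : S.pa j => W i)
      = inner ℝ w (totalDifferential M (S.U j) (S.θ j) (Q j) (S.forwardPa Q j) x) := by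
  rw [← ContinuousLinearMap.adjoint_inner_left, WithLp.prod_inner_apply]
  rfl

theorem adjoint_fst_mem (Q : Fin (n + 1) → ProbabilityMeasure Z) (j : Fin (n + 1)) (w : W j) :
    (S.adjoint Q j w).fst ∈ modelTangentSpace M (Q j) :=
  Subtype.property _

theorem backward_succ (Q : Fin (n + 1) → ProbabilityMeasure Z) (δ : ∀ j, S.AugSpace (Q j) j)
    (fk : W (Fin.last n)) {m : ℕ} (hm : m < n + 1) :
    S.backward Q δ fk (m + 1) = S.augment Q (Fin.rev ⟨m, hm⟩)
      (S.vartheta Q δ fk (Fin.rev ⟨m, hm⟩)) (S.backward Q δ fk m) := by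
  rw [backward, dif_pos hm, vartheta, Fin.rev_rev]

theorem backward_fst (Q : Fin (n + 1) → ProbabilityMeasure Z) (δ : ∀ j, S.AugSpace (Q j) j)
    (fk : W (Fin.last n)) {m : ℕ} (hm : m ≤ n + 1) (z : Z) :
    (S.backward Q δ fk m).1 z
      = ∑ j : Fin (n + 1), if (Fin.rev j : ℕ) < m then (S.vartheta Q δ fk j).fst z else 0 := by
  induction m with
  | zero => simp [backward]
  | succ m ih =>
    have hstep : ∀ j : Fin (n + 1),
        (if (Fin.rev j : ℕ) < m + 1 then (S.vartheta Q δ fk j).fst z else 0)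
        = (if (Fin.rev j : ℕ) < m then (S.vartheta Q δ fk j).fst z else 0)
          + if j = Fin.rev ⟨m, hm⟩ then (S.vartheta Q δ fk j).fst z else 0 := by
      intro j
      have hj : j = Fin.rev ⟨m, hm⟩ ↔ (Fin.rev j : ℕ) = m := by
        rw [← Fin.rev_inj, Fin.rev_rev, Fin.ext_iff]
      simp only [hj]
      split_ifs <;> first | omega | simp
    rw [S.backward_succ Q δ fk hm]
    simp only [hstep, Finset.sum_add_distrib, ← ih (by omega), Finset.sum_ite_eq',
      Finset.mem_univ, if_true]
    rfl

theorem influence_apply (Q : Fin (n + 1) → ProbabilityMeasure Z) (δ : ∀ j, S.AugSpace (Q j) j)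
    (fk : W (Fin.last n)) (z : Z) :
    S.influence Q δ fk z = ∑ j, (S.vartheta Q δ fk j).fst z := by
  rw [influence, S.backward_fst Q δ fk le_rfl]
  exact Finset.sum_congr rfl fun j _ => if_pos (Fin.rev j).2

/-- Reverse-mode differentiation computes the same derivative as forward-mode differentiation. -/
theorem sum_inner_vartheta (Q : Fin (n + 1) → ProbabilityMeasure Z)
    (δ : ∀ j, S.AugSpace (Q j) j) (fk : W (Fin.last n)) (s : ∀ j, L2 (Q j)) (t : ∀ j, W j)
    (h : ∀ j, inner ℝ (S.vartheta Q δ fk j).fst (s j)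
        + inner ℝ (S.vartheta Q δ fk j).snd (WithLp.toLp 2 fun i : S.pa j => t i)
      = inner ℝ ((S.backward Q δ fk (Fin.rev j)).2 j) (t j)) :
    ∑ j, inner ℝ (S.vartheta Q δ fk j).fst (s j) = inner ℝ fk (t (Fin.last n)) := by
  -- Invariant of the backward pass: nodes already treated contribute their score pairing, the
  -- others `⟨f_j, t_j⟩`. At `m = 0` only the last node has nonzero `f_j`; at `m = n + 1` only score
  -- pairings remain.
  have inv : ∀ m, m ≤ n + 1 → (∑ j : Fin (n + 1), if (Fin.rev j : ℕ) < m then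
      inner ℝ (S.vartheta Q δ fk j).fst (s j) else
      inner ℝ ((S.backward Q δ fk m).2 j) (t j)) = inner ℝ fk (t (Fin.last n)) := by
    intro m hm
    induction m with
    | zero =>
      rw [Finset.sum_eq_single (Fin.last n)]
      · simp [backward]
      · intro j _ hj
        simp [backward, Pi.single_eq_of_ne hj]
      · simp
    | succ m ih =>
      rw [← ih (by omega)]
      set k : Fin (n + 1) := Fin.rev ⟨m, hm⟩ with hk
      have hrev : Fin.rev k = ⟨m, hm⟩ := by rw [hk, Fin.rev_rev]
      -- The amounts by which step `k` raises the pairings of its parents, extended by zero. Their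
      -- sum compensates exactly for replacing `⟨f_k, t_k⟩` by the score pairing of `k`.
      let F : Fin (n + 1) → ℝ := fun j =>
        if hj : j ∈ S.pa k then inner ℝ ((S.vartheta Q δ fk k).snd ⟨j, hj⟩) (t j) else 0
      have hF : ∑ j, F j
          = inner ℝ (S.vartheta Q δ fk k).snd (WithLp.toLp 2 fun i : S.pa k => t i) := by
        rw [PiLp.inner_apply, ← Finset.sum_subset (Finset.subset_univ (S.pa k))
          (fun j _ hj => dif_neg hj), ← Finset.sum_coe_sort]
        exact Finset.sum_congr rfl fun i _ => dif_pos i.2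
      have hstep : ∀ j : Fin (n + 1), (if (Fin.rev j : ℕ) < m + 1 then
          inner ℝ (S.vartheta Q δ fk j).fst (s j) else
          inner ℝ ((S.backward Q δ fk (m + 1)).2 j) (t j))
          = (if (Fin.rev j : ℕ) < m then
              inner ℝ (S.vartheta Q δ fk j).fst (s j) else
              inner ℝ ((S.backward Q δ fk m).2 j) (t j))
            + ((if j = k then inner ℝ (S.vartheta Q δ fk j).fst (s j)
                - inner ℝ ((S.backward Q δ fk (Fin.rev j)).2 j) (t j) else 0) + F j) := by
        intro j
        have hjk : j = k ↔ (Fin.rev j : ℕ) = m := by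
          rw [hk, ← Fin.rev_inj, Fin.rev_rev, Fin.ext_iff]
        -- Parents have smaller indices, so they are still untreated after step `k` and their raised
        -- values count.
        have hpa : j ∈ S.pa k → m < (Fin.rev j : ℕ) := fun hj => by
          have := Fin.rev_lt_rev.2 (S.pa_lt k j hj)
          rwa [hrev, Fin.lt_def] at this
        rcases lt_trichotomy (Fin.rev j : ℕ) m with hlt | heq | hgt
        · have h1 : F j = 0 := dif_neg fun hj => by have := hpa hj; omega
          rw [if_pos (by omega), if_pos hlt, if_neg (by rw [hjk]; omega), h1]
          ring
        · have h1 : F j = 0 := dif_neg fun hj => by have := hpa hj; omega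
          rw [if_pos (by omega), if_neg (by omega), if_pos (hjk.2 heq), h1, heq]
          ring
        · rw [if_neg (by omega), if_neg (by omega), if_neg (by rw [hjk]; omega), zero_add,
            S.backward_succ Q δ fk hm]
          by_cases hj : j ∈ S.pa k
          · simp only [augment, F, ← hk, dif_pos hj, inner_add_left]
            rfl
          · simp only [augment, F, ← hk, dif_neg hj, add_zero]
      rw [Finset.sum_congr rfl fun j _ => hstep j, Finset.sum_add_distrib,
        Finset.sum_add_distrib, hF, Finset.sum_ite_eq', if_pos (Finset.mem_univ _), ← h k]
      ring
  rw [← inv (n + 1) le_rfl]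
  exact Finset.sum_congr rfl fun j _ => (if_pos (Fin.rev j).2).symm

/-- The adjoint takes values in the tangent space at `Q j`, where everything is centered, and the
error is centered by assumption. -/
theorem integral_vartheta_fst (Q : Fin (n + 1) → ProbabilityMeasure Z)
    (δ : ∀ j, S.AugSpace (Q j) j) (fk : W (Fin.last n)) (j : Fin (n + 1))
    (hδ : ∫ z, (δ j).fst z ∂(Q j : Measure Z) = 0) :
    ∫ z, (S.vartheta Q δ fk j).fst z ∂(Q j : Measure Z) = 0 := by
  have hint : ∀ f : L2 (Q j), Integrable f (Q j : Measure Z) :=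
    fun f => (Lp.memLp f).integrable (by norm_num)
  rw [vartheta, WithLp.add_fst, integral_congr_ae (Lp.coeFn_add _ _)]
  simp only [Pi.add_apply]
  rw [integral_add (hint _) (hint _), hδ, add_zero]
  exact integral_eq_zero_of_mem_modelTangentSpace (S.adjoint_fst_mem Q j _)

end Program

end

end AutoDiff

/-! ### Combining the two expansions -/

theorem lemmaS7 {Z : Type*} [MeasurableSpace Z]
    -- the model; all its elements are mutually absolutely continuous
    (M : Set (ProbabilityMeasure Z))
    (hM : ∀ P₁ ∈ M, ∀ P₂ ∈ M, (P₁ : Measure Z) ≪ (P₂ : Measure Z))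
    -- the `k = n + 1` ambient Hilbert spaces; the last one is the real line
    {n : ℕ} {W : Fin (n + 1) → Type*} [∀ j, NormedAddCommGroup (W j)]
    [∀ j, InnerProductSpace ℝ (W j)] [∀ j, CompleteSpace (W j)]
    (e : W (Fin.last n) ≃ₗᵢ[ℝ] ℝ)
    -- the real-valued parameter, expressed as a composition of primitives
    (S : Program M W) (ψ : ProbabilityMeasure Z → ℝ) (hψ : ∀ P' ∈ M, ψ P' = e (S.eval P'))
    (P : ProbabilityMeasure Z) (hP : P ∈ M)
    -- the smooth submodels through `P`
    (s : Fin (n + 1) → L2 P) (Pe : unitInterval → Fin (n + 1) → ProbabilityMeasure Z)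
    (hPe : ∀ j, IsModelPath M P (s j) (fun ε => Pe ε j))
    -- the errors of the adjoint evaluations (`𝓝 0` contains `ε = 0`, so that `δ 0 j = 0`)
    (δ : ∀ ε j, S.AugSpace (Pe ε j) j)
    (hδmean : ∀ ε j, ∫ z, (δ ε j).fst z ∂(Pe ε j : Measure Z) = 0)
    (hδlim : ∀ j, Tendsto (fun ε => ‖δ ε j‖) (𝓝 (0 : unitInterval)) (𝓝 0))
    -- total pathwise differentiability along the perturbed points
    (hdiff : ∀ ε j, TotallyPathwiseDifferentiableAt M (S.U j) (S.θ j) (Pe ε j)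
      (S.forwardPa (Pe ε) j))
    -- (i) uniform boundedness of the first entries
    (hbdd : ∀ j, ∃ c : ℝ, ∀ᶠ ε in 𝓝 (0 : unitInterval), ∀ᵐ z ∂(P : Measure Z),
      |(S.vartheta (Pe ε) (δ ε) (e.symm 1) j).fst z| ≤ c)
    -- (ii) convergence of the first entries in `L²(P)`
    (hconv : ∀ j, Tendsto
      (fun ε => eLpNorm (fun z => (S.vartheta (Pe ε) (δ ε) (e.symm 1) j).fst z
        - (S.vartheta (Pe 0) (δ 0) (e.symm 1) j).fst z) 2 (P : Measure Z))
      (𝓝 (0 : unitInterval)) (𝓝 0)) :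
    (∀ᶠ ε in 𝓝 (0 : unitInterval),
      Integrable (S.influence (Pe ε) (δ ε) (e.symm 1)) (P : Measure Z)) ∧
    (fun ε : unitInterval => e (S.forward (Pe ε) (Fin.last n))
        + (∫ z, S.influence (Pe ε) (δ ε) (e.symm 1) z ∂(P : Measure Z)) - ψ P)
      =o[𝓝 (0 : unitInterval)] fun ε => (ε : ℝ) := by
  -- `Pe 0 j` equals `P` only propositionally, so the scores are transported to `L2 (Pe 0 j)`, where
  -- the differentials at `ε = 0` live.
  obtain ⟨s', hs'⟩ : ∃ s' : ∀ j, L2 (Pe 0 j),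
      ∀ j, IsModelPath M (Pe 0 j) (s' j) fun ε => Pe ε j := by
    have : ∀ j, ∃ s' : L2 (Pe 0 j), IsModelPath M (Pe 0 j) s' fun ε => Pe ε j := by
      intro j
      rw [show Pe 0 j = P from (hPe j).2.1]
      exact ⟨_, hPe j⟩
    exact ⟨fun j => (this j).choose, fun j => (this j).choose_spec⟩
  have hP0 : ∀ j, Pe 0 j = P := fun j => (hPe j).2.1
  have hPM : ∀ ε j, Pe ε j ∈ M := fun ε j => (hPe j).1 ε
  have hδ0 : ∀ j, δ 0 j = 0 := fun j => norm_eq_zero.1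
    (eq_of_tendsto_nhds (f := fun ε => ‖δ ε j‖) (hδlim j))
  obtain ⟨t, ht⟩ := S.exists_forward_derivative (hdiff 0) hs'
  have hpair : ∑ j, inner ℝ (S.vartheta (Pe 0) (δ 0) (e.symm 1) j).fst (s' j)
      = e (t (Fin.last n)) := by
    have hinner : inner ℝ (e.symm 1) (t (Fin.last n)) = e (t (Fin.last n)) := by
      rw [← e.inner_map_map, e.apply_symm_apply]
      simp
    rw [← hinner]
    refine S.sum_inner_vartheta (Pe 0) (δ 0) (e.symm 1) s' t fun j => ?_
    obtain ⟨-, hsj, htj, htD⟩ := ht j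
    rw [Program.vartheta, hδ0, add_zero]
    exact (S.inner_adjoint (Pe 0) j _ (WithLp.toLp 2 (⟨s' j, hsj⟩, ⟨_, htj⟩))).trans
      (congrArg _ htD.symm)
  set g : Fin (n + 1) → unitInterval → Z → ℝ :=
    fun j ε z => (S.vartheta (Pe ε) (δ ε) (e.symm 1) j).fst z
  have hgm : ∀ j ε, StronglyMeasurable (g j ε) := fun j ε => Lp.stronglyMeasurable _
  choose c hc using hbdd
  have hgint : ∀ᶠ ε in 𝓝 (0 : unitInterval), ∀ j, Integrable (g j ε) (P : Measure Z) :=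
    eventually_all.2 fun j => (hc j).mono fun ε hε =>
      Integrable.of_bound (hgm j ε).aestronglyMeasurable (c j) hε
  have hinfl : ∀ ε, S.influence (Pe ε) (δ ε) (e.symm 1) = fun z => ∑ j, g j ε z :=
    fun ε => funext fun z => S.influence_apply _ _ _ z
  have hback : ∀ j, (fun ε : unitInterval => ∫ z, g j ε z ∂(P : Measure Z)
      + (ε : ℝ) * inner ℝ (S.vartheta (Pe 0) (δ 0) (e.symm 1) j).fst (s' j))
      =o[𝓝 (0 : unitInterval)] fun ε => (ε : ℝ) := by
    intro j
    have hexp := (hs' j).integral_sub_integral_isLittleO (g := g j) (c := c j) (hgm j)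
      (by rw [hP0 j]; exact hc j)
      -- Absolute continuity carries the `P`-a.s. bound over to `P_{j,ε}`.
      ((hc j).mono fun ε hε => (hM _ (hPM ε j) P hP).ae_le hε)
      (by rw [hP0 j]; exact hconv j)
    refine hexp.neg_left.congr_left fun ε => ?_
    have hinn : inner ℝ (S.vartheta (Pe 0) (δ 0) (e.symm 1) j).fst (s' j)
        = ∫ z, g j 0 z * s' j z ∂(Pe 0 j : Measure Z) := by
      rw [L2.inner_def]
      exact integral_congr_ae (ae_of_all _ fun z => mul_comm _ _)
    have h0 : ∫ z, g j ε z ∂(Pe ε j : Measure Z) = 0 :=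
      S.integral_vartheta_fst (Pe ε) (δ ε) (e.symm 1) j (hδmean ε j)
    have hPint : ∫ z, g j ε z ∂(P : Measure Z) = ∫ z, g j ε z ∂(Pe 0 j : Measure Z) := by
      rw [hP0 j]
    rw [hinn, h0, hPint]
    ring
  have hforw : (fun ε : unitInterval => e (S.forward (Pe ε) (Fin.last n)) - ψ P
      - (ε : ℝ) * e (t (Fin.last n))) =o[𝓝 (0 : unitInterval)] fun ε => (ε : ℝ) := by
    have hψP : ψ P = e (S.forward (Pe 0) (Fin.last n)) := by
      rw [hψ P hP, Program.eval, show Pe 0 = fun _ => P from funext hP0]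
    refine IsLittleO.congr_left (f₁ := fun ε : unitInterval => e (S.forward (Pe ε) (Fin.last n)
      - S.forward (Pe 0) (Fin.last n) - (ε : ℝ) • t (Fin.last n))) ?_ fun ε => ?_
    · exact IsLittleO.of_norm_left ((ht (Fin.last n)).1.norm_left.congr_left
        fun ε => (e.norm_map _).symm)
    · rw [map_sub, map_sub, map_smul, smul_eq_mul, hψP]
  refine ⟨hgint.mono fun ε hε => ?_, ?_⟩
  · rw [hinfl]
    exact integrable_finsetSum _ fun j _ => hε j
  -- The linear terms are `-ε t_k` from the forward pass and `ε ∑ j ⟨ϑ_{j,0,0}, s_j⟩` from the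
  -- backward pass; `hpair` cancels them.
  · refine (hforw.add (IsLittleO.sum fun j (_ : j ∈ Finset.univ) => hback j)).congr' ?_
      EventuallyEq.rfl
    filter_upwards [hgint] with ε hε
    rw [hinfl, integral_finsetSum _ fun j _ => hε j, Finset.sum_apply, Finset.sum_add_distrib, ← Finset.mul_sum,
      hpair]
    ring
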